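/- **Setting.** Let $E$ be a countable set of events, $\mathcal A$ a set of participants and $\pi\colon E\to\mathcal A$ a function. A *CES* $\mathcal E=\langle\#,\vdash,\Vdash\rangle$ consists of an irreflexive symmetric conflict relation $\#\subseteq E\times E$ and two relations $\vdash,\Vdash$ between finite conflict-free subsets of $E$ and events, both saturated: if $X\circ e$, $X\subseteq Y$, and $Y$ is finite and conflict-free, then $Y\circ e$. It is *conflict-free* if $\#=\emptyset$. A *contract* $\mathcal C=\langle\mathcal E,\Phi\rangle$ adds a payoff $\Phi\colon\mathcal A\to\wp(E^\infty)$, where $E^\infty$ is the set of finite or infinite sequences over $E$. **Plays.** For $\sigma=\langle e_0e_1\cdots\rangle$, $\overline\sigma$ is its set of events and $\sigma_i=\langle e_0\cdots e_{i-1}\rangle$ (with $\sigma_i=\sigma$ for $i\ge|\sigma|$). A *play* is a sequence without repetitions whose set of events is conflict-free. The *credits* of a finite sequence $\eta=\langle e_0\cdots e_{n-1}\rangle$ are $\mathrm{cr}(\eta)=\{e_i : \overline{\eta_i}\not\vdash e_i \text{ and } \overline{\eta}\not\Vdash e_i\}$. **Strategies.** A *strategy* $\Sigma$ for $A$ maps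 each finite play $\sigma$ to a set of events $e\in\pi^{-1}(A)$ such that $\sigma e$ is a play. A play $\sigma$ *conforms* to $\Sigma$ if $e_i\in\Sigma(\sigma_i)$ whenever $\pi(e_i)=A$; it is *fair* w.r.t. $\Sigma$ if, whenever $e\in\Sigma(\sigma_j)$ for all $j\ge i$, then $e_h=e$ for some $h\ge i$. **Prudence and innocence** are defined by mutual coinduction (prudence of events is the greatest solution). A strategy $\Sigma$ for $A$ is *prudent with past $\sigma$*, where $\sigma$ is a finite play conforming to $\Sigma$, if for every fair play $\sigma'$ that extends $\sigma$, conforms to $\Sigma$, and in which all $B\ne A$ are innocent, there is $k>|\sigma|$ with $\mathrm{cr}(\sigma'_k)\cap\pi^{-1}(A)\subseteq\mathrm{cr}(\sigma)$. An event $e$ is *prudent in $\sigma$* if $e\in\Sigma(\sigma)$ for some strategy $\Sigma$ for $\pi(e)$ that is prudent with past $\sigma$. A participant $A$ is *innocent* in a play $\sigma$ if for all $e\in\pi^{-1}(A)$ and all $i$ there is $j\ge i$ such that $e$ is not prudent in $\sigma_j$, and *culpable* otherwise. A strategy is *prudent* if it is prudent with every past, i.e. with every finite play conforming to it. **Winning.**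 $A$ is *credit-free* in $\sigma$ if for all $e\in\pi^{-1}(A)$ and all $i$ there is $j\ge i$ with $e\notin\mathrm{cr}(\sigma_j)$. $A$ *wins* in a play $\sigma$ if either $\sigma\in\Phi(A)$, $A$ is credit-free in $\sigma$ and all participants are innocent in $\sigma$, or $A$ is innocent and some $B\neq A$ is culpable in $\sigma$. A strategy for $A$ is *winning* if $A$ wins in every fair play conforming to it; $\mathcal C$ *admits an agreement* if every participant has a winning strategy. $\Phi$ is a *reachability payoff* if $\overline\sigma=\overline\eta$ implies $\sigma\in\Phi(A)\iff\eta\in\Phi(A)$, for all $A$. **Urgent atoms.** A Horn theory $\Delta$ is a set of clauses $\bigwedge X\to a$ and $\bigwedge X\twoheadrightarrow a$, with $X\subseteq E$ finite and $a\in E$; the atom $a$ stands for $\top\to a$. The set $[\![\Delta]\!]$ of *proof traces* is defined inductively: $\epsilon\in[\![\Delta]\!]$; if $(\bigwedge X\to a)\in\Delta$, $\sigma\in[\![\Delta]\!]$ and $X\subseteq\overline\sigma$, then $\sigma a\in[\![\Delta]\!]$; if $(\bigwedge X\twoheadrightarrow a)\in\Delta$, $\sigma\in[\![\Delta,a]\!]$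 and $X\subseteq\overline\sigma$, then every interleaving of $\sigma$ and $a$ is in $[\![\Delta]\!]$ (in both cases only the leftmost occurrence of each atom is kept). The set of *urgent* atoms of $\Delta$ at $X\subseteq E$ is $\mathcal U_\Delta(X)=\{a\notin X : \exists\sigma,\sigma'.\ \overline\sigma=X,\ \sigma a\sigma'\in[\![\Delta,X]\!]\}$. We write $\Delta\sim\mathcal E$ if $\mathcal E$ is conflict-free and $\Delta=\{\bigwedge X\to e : X\vdash e\}\cup\{\bigwedge X\twoheadrightarrow e : X\Vdash e\}$. **Theorem.** Let $\mathcal C=\langle\mathcal E,\Phi\rangle$ be a contract and $\Delta\sim\mathcal E$. Assume that the set of events $e$ having some enabling $X\vdash e$ or $X\Vdash e$ is finite (as is the case when $E$ is finite, or when $\vdash$ and $\Vdash$ are the saturations of finitely many enablings). For a participant $A$ let $$\Sigma_A(\sigma)=\mathcal U_\Delta(\overline\sigma)\cap\pi^{-1}(A).$$ Then $\Sigma_A$ is a prudent strategy for $A$. If moreover $\Phi$ is a reachability payoff and $\mathcal C$ admits an agreement, then $\Sigma_A$ is winning for $A$. -/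

import Mathlib

namespace ContractGames

variable {E : Type*} {Part : Type*}

/-! ### Event structures with circular causality -/

/-- A set of events is conflict-free when no two of its elements are in conflict. -/
def ConflictFree (conflict : E → E → Prop) (X : Set E) : Prop :=
  ∀ e ∈ X, ∀ e' ∈ X, ¬ conflict e e'

/-- An event structure with circular causality over the events `E`: an irreflexive and
symmetric conflict relation, and two saturated relations (enabling and circular enabling)
between finite conflict-free sets of events and events. -/
structure CES (E : Type*) where
  conflict : E → E → Prop
  conflict_irrefl : ∀ e, ¬ conflict e e
  conflict_symm : ∀ e e', conflict e e' → conflict e' e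
  enables : Set E → E → Prop
  enables_con : ∀ X e, enables X e → X.Finite ∧ ConflictFree conflict X
  enables_saturated : ∀ X Y e, X ⊆ Y → Y.Finite → enables X e →
    ConflictFree conflict Y → enables Y e
  circEnables : Set E → E → Prop
  circEnables_con : ∀ X e, circEnables X e → X.Finite ∧ ConflictFree conflict X
  circEnables_saturated : ∀ X Y e, X ⊆ Y → Y.Finite → circEnables X e →
    ConflictFree conflict Y → circEnables Y e

/-- The event structure has an empty conflict relation. -/
def CES.IsConflictFree (ces : CES E) : Prop :=
  ∀ e e', ¬ ces.conflict e e'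

/-- The events that have at least one (circular) enabling. -/
def CES.enabledEvents (ces : CES E) : Set E :=
  {e | ∃ X, ces.enables X e ∨ ces.circEnables X e}

/-! ### Sequences and plays

A finite or infinite sequence of events is a term of `Stream'.Seq E`, a finite one is a list.
The prefix `σ_i` is `σ.take i`; for a finite `σ` and `i ≥ |σ|` it is the whole of `σ`. -/

/-- The set of the events that occur in a sequence. -/
def events (σ : Stream'.Seq E) : Set E := {e | ∃ i, σ.get? i = some e}

/-- A finite play: a conflict-free finite sequence without repetitions. -/
def IsFinPlay (ces : CES E) (σ : List E) : Prop :=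
  σ.Nodup ∧ ConflictFree ces.conflict {e | e ∈ σ}

/-- A play: a conflict-free, finite or infinite sequence without repetitions. -/
def IsPlay (ces : CES E) (σ : Stream'.Seq E) : Prop :=
  (∀ i j e, σ.get? i = some e → σ.get? j = some e → i = j) ∧
    ConflictFree ces.conflict (events σ)

/-- The credits of a finite sequence: the events that are neither enabled by the events
before them, nor circularly enabled by the whole sequence. -/
def credits (ces : CES E) (η : List E) : Set E :=
  {e | ∃ i, η[i]? = some e ∧ ¬ ces.enables {x | x ∈ η.take i} e ∧
    ¬ ces.circEnables {x | x ∈ η} e}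

/-! ### Strategies -/

/-- `S` is a strategy for participant `A`: to each finite play it associates events of `A`
that extend it to a play. (The values of `S` on lists that are not plays are irrelevant.) -/
def IsStrategy (ces : CES E) (owner : E → Part) (A : Part) (S : List E → Set E) : Prop :=
  ∀ σ, IsFinPlay ces σ → ∀ e ∈ S σ, owner e = A ∧ IsFinPlay ces (σ ++ [e])

/-- The sequence `σ` conforms to the strategy `S` for `A`. -/
def Conforms (owner : E → Part) (A : Part) (S : List E → Set E) (σ : Stream'.Seq E) : Prop :=
  ∀ i e, σ.get? i = some e → owner e = A → e ∈ S (σ.take i)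

/-- The sequence `σ` is fair with respect to the strategy `S`: each event that `S` enables
perpetually from some point on is fired after this point. -/
def Fair (S : List E → Set E) (σ : Stream'.Seq E) : Prop :=
  ∀ i e, (∀ j, i ≤ j → e ∈ S (σ.take j)) → ∃ h, i ≤ h ∧ σ.get? h = some e

/-! ### Prudence and innocence

Both notions are first defined relative to a relation `P σ e`, read "`e` is prudent in `σ`".
Prudence of events is then the coinductive (greatest) solution of the resulting equation. -/

/-- Participant `A` is innocent in `σ`, when the prudent events are those given by `P`. -/
def InnocentRel (owner : E → Part) (P : List E → E → Prop) (A : Part)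
    (σ : Stream'.Seq E) : Prop :=
  ∀ e, owner e = A → ∀ i, ∃ j, i ≤ j ∧ ¬ P (σ.take j) e

/-- `S` is a prudent strategy for `A` with past `σ` (hence `σ` conforms to `S`), when the
prudent events are those given by `P`. -/
def PrudentWithPastRel (ces : CES E) (owner : E → Part) (P : List E → E → Prop) (A : Part)
    (S : List E → Set E) (σ : List E) : Prop :=
  IsStrategy ces owner A S ∧ IsFinPlay ces σ ∧ Conforms owner A S (Stream'.Seq.ofList σ) ∧
    ∀ σ' : Stream'.Seq E, IsPlay ces σ' → σ'.take σ.length = σ →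
      Fair S σ' → Conforms owner A S σ' → (∀ B, B ≠ A → InnocentRel owner P B σ') →
      ∃ k, σ.length < k ∧ credits ces (σ'.take k) ∩ {e | owner e = A} ⊆ credits ces σ

/-- The operator of which event prudence is the greatest fixed point: `e` is prudent in `σ`
when some prudent strategy with past `σ` prescribes it in `σ`. -/
def prudenceOp (ces : CES E) (owner : E → Part) :
    (List E → E → Prop) →o (List E → E → Prop) where
  toFun P σ e := ∃ S, PrudentWithPastRel ces owner P (owner e) S σ ∧ e ∈ S σ
  monotone' := by
    rintro P Q hPQ σ e ⟨S, ⟨h1, h2, h3, h4⟩, he⟩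
    refine ⟨S, ⟨h1, h2, h3, fun σ' hp ht hf hc hi => h4 σ' hp ht hf hc ?_⟩, he⟩
    intro B hB x hx i
    obtain ⟨j, hj, hn⟩ := hi B hB x hx i
    exact ⟨j, hj, fun h => hn (hPQ _ _ h)⟩

/-- The event `e` is prudent in the finite play `σ`. -/
def PrudentEvent (ces : CES E) (owner : E → Part) : List E → E → Prop :=
  OrderHom.gfp (prudenceOp ces owner)

/-- Participant `A` is innocent in `σ` (otherwise `A` is culpable). -/
def Innocent (ces : CES E) (owner : E → Part) (A : Part) (σ : Stream'.Seq E) : Prop :=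
  InnocentRel owner (PrudentEvent ces owner) A σ

/-- `S` is a prudent strategy for `A` with past `σ`. -/
def PrudentWithPast (ces : CES E) (owner : E → Part) (A : Part) (S : List E → Set E)
    (σ : List E) : Prop :=
  PrudentWithPastRel ces owner (PrudentEvent ces owner) A S σ

/-- The mutual equations are satisfied. -/
theorem prudentEvent_iff (ces : CES E) (owner : E → Part) (σ : List E) (e : E) :
    PrudentEvent ces owner σ e ↔ ∃ S, PrudentWithPast ces owner (owner e) S σ ∧ e ∈ S σ := by
  have h := OrderHom.map_gfp (prudenceOp ces owner)
  exact Iff.of_eq (congrFun (congrFun h σ) e).symm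

/-- `S` is a prudent strategy for `A`: it is prudent with every past, that is, with every
finite play that conforms to it. -/
def IsPrudentStrategy (ces : CES E) (owner : E → Part) (A : Part) (S : List E → Set E) :
    Prop :=
  IsStrategy ces owner A S ∧
    ∀ σ, IsFinPlay ces σ → Conforms owner A S (Stream'.Seq.ofList σ) →
      PrudentWithPast ces owner A S σ

/-! ### Contracts, winning and agreement -/

/-- A contract: a CES with, for each participant, the set of sequences where the payoff of
this participant is positive. -/
structure Contract (E : Type*) (Part : Type*) where
  ces : CES E
  payoff : Part → Set (Stream'.Seq E)

/-- Participant `A` is credit-free in `σ`. -/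
def CreditFree (ces : CES E) (owner : E → Part) (A : Part) (σ : Stream'.Seq E) : Prop :=
  ∀ e, owner e = A → ∀ i, ∃ j, i ≤ j ∧ e ∉ credits ces (σ.take j)

/-- Participant `A` wins in the play `σ`. -/
def Wins (C : Contract E Part) (owner : E → Part) (A : Part) (σ : Stream'.Seq E) : Prop :=
  (σ ∈ C.payoff A ∧ CreditFree C.ces owner A σ ∧ ∀ B, Innocent C.ces owner B σ) ∨
    (Innocent C.ces owner A σ ∧ ∃ B, B ≠ A ∧ ¬ Innocent C.ces owner B σ)

/-- `S` is a winning strategy for `A`. -/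
def IsWinningStrategy (C : Contract E Part) (owner : E → Part) (A : Part)
    (S : List E → Set E) : Prop :=
  IsStrategy C.ces owner A S ∧
    ∀ σ, IsPlay C.ces σ → Fair S σ → Conforms owner A S σ → Wins C owner A σ

/-- The contract admits an agreement: each participant has a winning strategy. -/
def AdmitsAgreement (C : Contract E Part) (owner : E → Part) : Prop :=
  ∀ A, ∃ S, IsWinningStrategy C owner A S

/-- Reachability payoffs depend only on the set of the events that occur. -/
def IsReachabilityPayoff (payoff : Part → Set (Stream'.Seq E)) : Prop :=
  ∀ A σ η, events σ = events η → (σ ∈ payoff A ↔ η ∈ payoff A)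

/-! ### Horn theories of propositional contract logic -/

/-- Horn clauses: `imp X a` is the implication from the conjunction of the atoms in `X` to
`a`, and `cimp X a` is the contractual implication. The clause `imp ∅ a` is the atom `a`. -/
inductive HornClause (E : Type*) where
  | imp (body : Finset E) (head : E) : HornClause E
  | cimp (body : Finset E) (head : E) : HornClause E

/-- The correspondence between Horn theories and conflict-free event structures. -/
def Corresponds (Δ : Set (HornClause E)) (ces : CES E) : Prop :=
  ces.IsConflictFree ∧
    Δ = {c | ∃ (X : Finset E) (e : E), ces.enables X e ∧ c = HornClause.imp X e} ∪
      {c | ∃ (X : Finset E) (e : E), ces.circEnables X e ∧ c = HornClause.cimp X e}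

open Classical in
/-- Removal of the duplicates of a list, where the leftmost occurrences are kept. -/
noncomputable def removeDup : List E → List E
  | [] => []
  | a :: l => a :: (removeDup l).filter (fun x => x ≠ a)

/-- The proof traces of a Horn theory. In the last rule, the lists `τ ++ a :: ρ` with
`τ ++ ρ = σ` are the interleavings of `σ` and the one-element sequence `a`. -/
inductive ProofTrace : Set (HornClause E) → List E → Prop where
  | nil (Δ : Set (HornClause E)) : ProofTrace Δ []
  | imp (Δ : Set (HornClause E)) (X : Finset E) (a : E) (σ : List E) :
      HornClause.imp X a ∈ Δ → ProofTrace Δ σ → (∀ x ∈ X, x ∈ σ) →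
      ProofTrace Δ (removeDup (σ ++ [a]))
  | cimp (Δ : Set (HornClause E)) (X : Finset E) (a : E) (σ τ ρ : List E) :
      HornClause.cimp X a ∈ Δ → ProofTrace (insert (HornClause.imp ∅ a) Δ) σ →
      (∀ x ∈ X, x ∈ σ) → τ ++ ρ = σ →
      ProofTrace Δ (removeDup (τ ++ a :: ρ))

/-- The atoms that are urgent in the theory `Δ` at the set of atoms `X`. -/
def urgent (Δ : Set (HornClause E)) (X : Set E) : Set E :=
  {a | a ∉ X ∧ ∃ σ σ' : List E, {x | x ∈ σ} = X ∧
    ProofTrace (Δ ∪ {c | ∃ x ∈ X, c = HornClause.imp ∅ x}) (σ ++ a :: σ')}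

/-- The strategy that prescribes to `A` the events of `A` that are urgent at the set of the
events already occurred. -/
def urgentStrategy (Δ : Set (HornClause E)) (owner : E → Part) (A : Part) :
    List E → Set E :=
  fun σ => urgent Δ {x | x ∈ σ} ∩ {e | owner e = A}

end ContractGames

namespace ContractGames

variable {E : Type*} {Part : Type*}

/-! ### Justified lists -/

/-! The core is that an event is prudent in a finite play exactly when it is urgent there. By
`mem_urgent_iff`, `a` is urgent at a finite `X` not containing it iff some list `a :: l` is
justified from `X`: each entry is already present, or follows from what precedes it by `→`, or
follows from `X` and the whole list by `↠`. Such lists survive enlarging `X`, so an urgent event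
stays urgent until it is fired.

Urgent implies prudent (`prudentEvent_of_urgent`), by coinduction. If `A` plays its urgent events
fairly and the others are innocent, no event is urgent forever, so every urgent event is eventually
fired (`Live`). Hence the whole list that witnesses an urgent move is fired, and the credit taken by
that move is honoured at some finite stage. Only finitely many events have an enabling, so one stage
serves for all new moves.

Prudent implies urgent (`urgent_of_prudentEvent`), by induction on the number of enabled events not
yet fired. Let a prudent strategy run, after the event, against opponents who play their prudent
events. At some stage the moves of the strategy are all justified; those of the opponents are urgent
by induction, and their witnesses can be appended.

For winning, the equivalence makes `A` innocent. If nobody is culpable, the play is live and the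
events of `A` are credit-free. For the payoff, the others replay their events of this play against a
given winning strategy of `A`; that strategy must win with positive payoff, and
`Live.subset_events_of_settled`, applied in both directions, shows that both plays have the same
events. Reachability of the payoff concludes. -/

/-- Every entry `e` of the list satisfies `J Y e`, where `Y` consists of `X` and of the entries
that precede `e`. -/
def SoundBy (J : Set E → E → Prop) : Set E → List E → Prop
  | _, [] => True
  | X, e :: l => J X e ∧ SoundBy J (insert e X) l

theorem SoundBy.mono {J J' : Set E → E → Prop}
    (hJ : ∀ X X' e, X ⊆ X' → J X e → J' X' e) {l : List E} :
    ∀ {X X' : Set E}, X ⊆ X' → SoundBy J X l → SoundBy J' X' l := by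
  induction l with
  | nil => intros; trivial
  | cons e l ih =>
    intro X X' hX h
    exact ⟨hJ _ _ _ hX h.1, ih (Set.insert_subset_insert hX) h.2⟩

theorem soundBy_append {J : Set E → E → Prop} {l l' : List E} :
    ∀ {X : Set E}, SoundBy J X (l ++ l') ↔ SoundBy J X l ∧ SoundBy J (X ∪ {x | x ∈ l}) l' := by
  induction l with
  | nil => intro X; simp [SoundBy]
  | cons e l ih =>
    intro X
    have : insert e X ∪ {x | x ∈ l} = X ∪ {x | x ∈ e :: l} := by
      ext x; simp only [Set.mem_union, Set.mem_insert_iff, Set.mem_ofPred_eq, List.mem_cons]; tauto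
    simp only [List.cons_append, SoundBy, ih, this, and_assoc]

theorem soundBy_of_getElem? {J : Set E → E → Prop} {l : List E} :
    ∀ {X : Set E}, (∀ i e, l[i]? = some e → J (X ∪ {x | x ∈ l.take i}) e) → SoundBy J X l := by
  induction l with
  | nil => intros; trivial
  | cons e l ih =>
    intro X h
    refine ⟨by simpa using h 0 e rfl, ih fun i e' he' => ?_⟩
    have := h (i + 1) e' (by simpa using he')
    have h2 : insert e X ∪ {x | x ∈ l.take i} = X ∪ {x | x ∈ (e :: l).take (i + 1)} := by
      ext x
      simp only [Set.mem_union, Set.mem_insert_iff, Set.mem_ofPred_eq, List.take_succ_cons,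
        List.mem_cons]; tauto
    rwa [h2]

theorem SoundBy.filter {J : Set E → E → Prop} (p : E → Bool) {l : List E} :
    ∀ {X : Set E}, (∀ e, p e = false → e ∈ X) → SoundBy J X l → SoundBy J X (l.filter p) := by
  induction l with
  | nil => intros; trivial
  | cons e l ih =>
    intro X hp h
    by_cases he : p e = true
    · rw [List.filter_cons_of_pos he]
      exact ⟨h.1, ih (fun x hx => Set.mem_insert_of_mem _ (hp x hx)) h.2⟩
    · rw [List.filter_cons_of_neg he]
      have heX : e ∈ X := hp e (by simpa using he)
      have := h.2
      rw [Set.insert_eq_of_mem heX] at this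
      exact ih hp this

theorem SoundBy.removeDup {J : Set E → E → Prop} {l : List E} : ∀ {X : Set E}, SoundBy J X l → SoundBy J X (removeDup l) := by
  induction l with
  | nil => intros; trivial
  | cons e l ih =>
    intro X h
    refine ⟨h.1, (ih h.2).filter _ fun x hx => ?_⟩
    simp only [decide_eq_false_iff_not, not_not] at hx
    exact Or.inl hx

/-! ### Removal of duplicates -/

@[simp] theorem mem_removeDup {x : E} {l : List E} : x ∈ removeDup l ↔ x ∈ l := by
  induction l with
  | nil => simp [removeDup]
  | cons a l ih => simp [removeDup, ih]; tauto

theorem nodup_removeDup (l : List E) : (removeDup l).Nodup := by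
  induction l with
  | nil => simp [removeDup]
  | cons a l ih => simp [removeDup, ih.filter]

theorem removeDup_eq_self {l : List E} (h : l.Nodup) : removeDup l = l := by
  induction l with
  | nil => rfl
  | cons a l ih =>
    rw [List.nodup_cons] at h
    rw [removeDup, ih h.2, List.filter_eq_self.2]
    intro x hx
    simp only [decide_eq_true_eq]
    rintro rfl; exact h.1 hx

open Classical in
theorem removeDup_append (l l' : List E) :
    removeDup (l ++ l') = removeDup l ++ (removeDup l').filter (fun x => x ∉ l) := by
  induction l with
  | nil => simp [removeDup]
  | cons a l ih =>
    simp only [List.cons_append, removeDup, ih, List.filter_append, List.filter_filter,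
      List.cons.injEq, true_and, List.append_cancel_left_eq]
    apply List.filter_congr
    intro x _
    simp

/-- Cut just before the occurrence of `a`: the inserted copy becomes the leftmost one and the
original is dropped. Thus discharging `a` by the `↠` rule can leave a trace unchanged. -/
theorem exists_removeDup_insert {l : List E} (hl : l.Nodup) {a : E} (ha : a ∈ l) :
    ∃ τ ρ, τ ++ ρ = l ∧ removeDup (τ ++ a :: ρ) = l := by
  obtain ⟨τ, ρ, rfl⟩ := List.append_of_mem ha
  refine ⟨τ, a :: ρ, rfl, ?_⟩
  have h := removeDup_eq_self hl
  rw [removeDup_append] at h ⊢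
  rw [← h]
  congr 2
  simp only [removeDup, List.filter_cons, List.filter_filter]
  simp

/-! ### Proof traces and justified lists -/

/-- An implication of the theory has head `e` and its body contained in `X`. -/
def Arr (Δ : Set (HornClause E)) (X : Set E) (e : E) : Prop :=
  ∃ B : Finset E, HornClause.imp B e ∈ Δ ∧ (B : Set E) ⊆ X

/-- A contractual implication of the theory has head `e` and its body contained in `X`. -/
def Circ (Δ : Set (HornClause E)) (X : Set E) (e : E) : Prop :=
  ∃ B : Finset E, HornClause.cimp B e ∈ Δ ∧ (B : Set E) ⊆ X

theorem Arr.mono {Δ : Set (HornClause E)} {X Y : Set E} {e : E} (h : Arr Δ X e) (hXY : X ⊆ Y) :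
    Arr Δ Y e := by
  obtain ⟨B, h1, h2⟩ := h; exact ⟨B, h1, h2.trans hXY⟩

theorem Circ.mono {Δ : Set (HornClause E)} {X Y : Set E} {e : E} (h : Circ Δ X e) (hXY : X ⊆ Y) :
    Circ Δ Y e := by
  obtain ⟨B, h1, h2⟩ := h; exact ⟨B, h1, h2.trans hXY⟩

/-- The event `e` is present in `X`, or follows from `X` by an implication, or from `Y` by a
contractual implication. -/
def Just (Δ : Set (HornClause E)) (Y X : Set E) (e : E) : Prop :=
  e ∈ X ∨ Arr Δ X e ∨ Circ Δ Y e

theorem Just.mono {Δ : Set (HornClause E)} {Y Y' X X' : Set E} {e : E} (hY : Y ⊆ Y')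
    (hX : X ⊆ X') (h : Just Δ Y X e) : Just Δ Y' X' e :=
  h.imp (fun h => hX h) (Or.imp (·.mono hX) (·.mono hY))

/-- Every entry of the list is justified by `X` and the entries before it, with `Y` as the set
of the events available for the contractual implications. -/
def Sound (Δ : Set (HornClause E)) (Y : Set E) : Set E → List E → Prop := SoundBy (Just Δ Y)

theorem Sound.mono {Δ : Set (HornClause E)} {Y Y' X X' : Set E} {l : List E} (hY : Y ⊆ Y')
    (hX : X ⊆ X') (h : Sound Δ Y X l) : Sound Δ Y' X' l :=
  SoundBy.mono (fun _ _ _ hX h => h.mono hY hX) hX h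

theorem ProofTrace.sound {Δ : Set (HornClause E)} {l : List E} (h : ProofTrace Δ l) :
    Sound Δ {x | x ∈ l} ∅ l := by
  induction h with
  | nil => trivial
  | imp Δ X a σ hX _ hσ ih =>
    refine SoundBy.removeDup ?_
    refine soundBy_append.2 ⟨Sound.mono (fun x hx => ?_) subset_rfl ih, ?_, trivial⟩
    · simpa using Or.inl hx
    · exact Or.inr (Or.inl ⟨X, hX, fun x hx => Or.inr (hσ x hx)⟩)
  | cimp Δ X a σ τ ρ hX _ hσ hτ ih =>
    subst hτ
    refine SoundBy.removeDup ?_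
    have hsub : {x | x ∈ τ ++ ρ} ⊆ {x | x ∈ removeDup (τ ++ a :: ρ)} := by
      intro x hx
      simp only [Set.mem_ofPred_eq, mem_removeDup, List.mem_append, List.mem_cons] at hx ⊢
      tauto
    have ha : Circ Δ {x | x ∈ removeDup (τ ++ a :: ρ)} a :=
      ⟨X, hX, fun x hx => hsub (hσ x hx)⟩
    -- Wherever the premise used the auxiliary atom `a`, the contractual clause now justifies it.
    have key : ∀ X X' : Set E, ∀ e, X ⊆ X' →
        Just (insert (HornClause.imp ∅ a) Δ) {x | x ∈ τ ++ ρ} X e →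
        Just Δ {x | x ∈ removeDup (τ ++ a :: ρ)} X' e := by
      rintro X X' e hXX' (h | ⟨B, h, hB⟩ | ⟨B, h, hB⟩)
      · exact Or.inl (hXX' h)
      · rcases h with h | h
        · obtain ⟨rfl, rfl⟩ := HornClause.imp.inj h
          exact Or.inr (Or.inr ha)
        · exact Or.inr (Or.inl ⟨B, h, hB.trans hXX'⟩)
      · rcases h with h | h
        · cases h
        · exact Or.inr (Or.inr ⟨B, h, hB.trans hsub⟩)
    have ih' := soundBy_append.1 ih
    refine soundBy_append.2 ⟨ih'.1.mono key subset_rfl, Or.inr (Or.inr ha), ?_⟩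
    exact ih'.2.mono key (Set.subset_insert _ _)

theorem proofTrace_removeDup_of_arr {Δ : Set (HornClause E)} {l : List E} :
    SoundBy (fun X e => e ∈ X ∨ Arr Δ X e) ∅ l → ProofTrace Δ (removeDup l) := by
  classical
  induction l using List.reverseRecOn with
  | nil => intro; exact ProofTrace.nil Δ
  | append_singleton l a ih =>
    intro h
    obtain ⟨h1, h2, -⟩ := soundBy_append.1 h
    rcases h2 with h2 | ⟨B, hB, h2⟩
    · have ha : a ∈ l := by simpa using h2
      rw [removeDup_append]
      simpa [removeDup, ha] using ih h1
    · have h3 := ProofTrace.imp Δ B a _ hB (ih h1) fun x hx => by simpa using h2 hx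
      rw [removeDup_append, removeDup_eq_self (nodup_removeDup l)] at h3
      rw [List.filter_congr (q := fun x => decide (x ∉ l)) fun x _ => by simp] at h3
      rwa [removeDup_append]

/-- The entries in `s` are the ones taken on credit. Each is turned into an atom of the theory, one
at a time, until only implications are needed; the `↠` rule then discharges these atoms in turn. -/
theorem proofTrace_removeDup {l : List E} (s : Finset E) : ∀ {Δ : Set (HornClause E)},
    (∀ a ∈ s, a ∈ l ∧ Circ Δ {x | x ∈ l} a) →
    SoundBy (fun X e => e ∈ X ∨ Arr Δ X e ∨ e ∈ s) ∅ l → ProofTrace Δ (removeDup l) := by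
  classical
  induction s using Finset.induction_on with
  | empty => intro Δ _ h; simpa using proofTrace_removeDup_of_arr (by simpa using h)
  | insert a s ha ih =>
    intro Δ hs h
    obtain ⟨hal, B, hB, hBl⟩ := hs a (Finset.mem_insert_self _ _)
    have h1 : ProofTrace (insert (HornClause.imp ∅ a) Δ) (removeDup l) := by
      apply ih
      · intro b hb
        obtain ⟨hbl, B', hB', hBl'⟩ := hs b (Finset.mem_insert_of_mem hb)
        exact ⟨hbl, B', Or.inr hB', hBl'⟩
      · refine h.mono ?_ subset_rfl
        rintro X X' e hX (h | ⟨B', h, h'⟩ | h)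
        · exact Or.inl (hX h)
        · exact Or.inr (Or.inl ⟨B', Or.inr h, h'.trans hX⟩)
        · rcases Finset.mem_insert.1 h with rfl | h
          · exact Or.inr (Or.inl ⟨∅, Or.inl rfl, by simp⟩)
          · exact Or.inr (Or.inr h)
    obtain ⟨τ, ρ, h2, h3⟩ := exists_removeDup_insert (nodup_removeDup l) (mem_removeDup.2 hal)
    rw [← h3]
    exact ProofTrace.cimp Δ B a _ τ ρ hB h1 (fun x hx => mem_removeDup.2 (hBl hx)) h2

theorem Sound.proofTrace {Δ : Set (HornClause E)} {l : List E} (h : Sound Δ {x | x ∈ l} ∅ l) :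
    ProofTrace Δ (removeDup l) := by
  classical
  refine proofTrace_removeDup (l.toFinset.filter fun a => Circ Δ {x | x ∈ l} a) ?_ ?_
  · intro a ha; simpa using ha
  · have : ∀ m : List E, m ⊆ l → ∀ X, Sound Δ {x | x ∈ l} X m → SoundBy (fun X e => e ∈ X ∨
        Arr Δ X e ∨ e ∈ l.toFinset.filter fun a => Circ Δ {x | x ∈ l} a) X m := by
      intro m
      induction m with
      | nil => intros; trivial
      | cons e m ih =>
        intro hm X h
        refine ⟨h.1.imp_right (Or.imp_right fun h => ?_),
          ih (fun x hx => hm (List.mem_cons_of_mem _ hx)) _ h.2⟩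
        simpa using ⟨hm List.mem_cons_self, h⟩
    exact this l (fun _ h => h) _ h

/-! ### Urgent events -/

theorem mem_urgent_iff {Δ : Set (HornClause E)} {X : Set E} {a : E} :
    a ∈ urgent Δ X ↔ X.Finite ∧ a ∉ X ∧
      ∃ l : List E, Sound Δ (X ∪ {x | x ∈ a :: l}) X (a :: l) := by
  constructor
  · rintro ⟨ha, σ, σ', rfl, h⟩
    refine ⟨σ.finite_toSet, ha, σ', ?_⟩
    have h1 := (soundBy_append.1 h.sound).2
    have h2 : {x | x ∈ σ ++ a :: σ'} = {x | x ∈ σ} ∪ {x | x ∈ a :: σ'} := by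
      ext x; simp
    rw [h2, Set.empty_union] at h1
    -- The atoms added to the theory are members of the starting set, so using one amounts to
    -- repeating an event already present.
    have key : ∀ m : List E, ∀ X, {x | x ∈ σ} ⊆ X →
        Sound (Δ ∪ {c | ∃ x ∈ {x | x ∈ σ}, c = HornClause.imp ∅ x})
          ({x | x ∈ σ} ∪ {x | x ∈ a :: σ'}) X m →
        Sound Δ ({x | x ∈ σ} ∪ {x | x ∈ a :: σ'}) X m := by
      intro m
      induction m with
      | nil => intros; trivial
      | cons e m ih =>
        intro X hX h
        refine ⟨?_, ih _ (hX.trans (Set.subset_insert _ _)) h.2⟩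
        rcases h.1 with h | ⟨B, h | h, hB⟩ | ⟨B, h | h, hB⟩
        · exact Or.inl h
        · exact Or.inr (Or.inl ⟨B, h, hB⟩)
        · obtain ⟨x, hx, h⟩ := h
          obtain ⟨rfl, rfl⟩ := HornClause.imp.inj h
          exact Or.inl (hX hx)
        · exact Or.inr (Or.inr ⟨B, h, hB⟩)
        · obtain ⟨x, hx, h⟩ := h
          cases h
    exact key _ _ subset_rfl h1
  · classical
    rintro ⟨hX, ha, l, h⟩
    obtain ⟨s, rfl⟩ := hX.exists_finset_coe
    have hs : {x | x ∈ s.toList} = (s : Set E) := by ext; simp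
    refine ⟨ha, s.toList, ((removeDup l).filter (fun x => x ≠ a)).filter (fun x => x ∉ s.toList),
      hs, ?_⟩
    have h2 : {x | x ∈ s.toList ++ a :: l} = (s : Set E) ∪ {x | x ∈ a :: l} := by
      ext x; simp
    have h1 : Sound (Δ ∪ {c | ∃ x ∈ (s : Set E), c = HornClause.imp ∅ x})
        {x | x ∈ s.toList ++ a :: l} ∅ (s.toList ++ a :: l) := by
      refine soundBy_append.2 ⟨soundBy_of_getElem? fun i e he => ?_, ?_⟩
      · refine Or.inr (Or.inl ⟨∅, Or.inr ⟨e, ?_, rfl⟩, by simp⟩)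
        simpa using List.mem_of_getElem? he
      · rw [h2]
        refine SoundBy.mono ?_ ?_ h
        · rintro X X' e hX (h | ⟨B, h, hB⟩ | ⟨B, h, hB⟩)
          · exact Or.inl (hX h)
          · exact Or.inr (Or.inl ⟨B, Or.inl h, hB.trans hX⟩)
          · exact Or.inr (Or.inr ⟨B, Or.inl h, hB⟩)
        · rw [hs]; exact Set.subset_union_right
    have h3 := h1.proofTrace
    have ha' : a ∉ s.toList := by simpa using ha
    rw [removeDup_append, removeDup_eq_self s.nodup_toList, removeDup,
      List.filter_cons_of_pos (by simpa using ha)] at h3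
    exact h3

theorem urgent_mono {Δ : Set (HornClause E)} {X Y : Set E} {a : E} (h : a ∈ urgent Δ X)
    (hXY : X ⊆ Y) (hY : Y.Finite) (ha : a ∉ Y) : a ∈ urgent Δ Y := by
  obtain ⟨-, -, l, hl⟩ := mem_urgent_iff.1 h
  exact mem_urgent_iff.2 ⟨hY, ha, l, hl.mono (Set.union_subset_union_left _ hXY) hXY⟩

/-- An urgent entry may rely on a witness list absent from `m`. Witnesses can wait until the end:
contractual clauses see the whole list, and a larger set of predecessors does no harm. -/
theorem exists_sound_of_urgent {J : Set E → E → Prop} {Δ : Set (HornClause E)} {Z : Set E}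
    {m : List E} (hJ : ∀ X e, J X e → Just Δ Z X e ∨ e ∈ urgent Δ X) : ∀ {X : Set E},
    X ⊆ Z → {x | x ∈ m} ⊆ Z → SoundBy J X m →
    ∃ l : List E, Sound Δ (Z ∪ {x | x ∈ l}) X (m ++ l) := by
  induction m with
  | nil => intros; exact ⟨[], trivial⟩
  | cons e m ih =>
    intro X hX hm h
    have he : e ∈ Z := hm List.mem_cons_self
    obtain ⟨l, hl⟩ := ih (Set.insert_subset he hX)
      (fun x hx => hm (List.mem_cons_of_mem _ hx)) h.2
    rcases hJ _ _ h.1 with h1 | h1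
    · exact ⟨l, h1.mono Set.subset_union_left subset_rfl, hl⟩
    · obtain ⟨-, -, q, hq⟩ := mem_urgent_iff.1 h1
      refine ⟨l ++ q, hq.1.mono ?_ subset_rfl, ?_⟩
      · intro x hx
        simp only [Set.mem_union, Set.mem_ofPred_eq, List.mem_cons, List.mem_append] at hx ⊢
        rcases hx with hx | rfl | hx
        exacts [Or.inl (hX hx), Or.inl he, Or.inr (Or.inr hx)]
      · change Sound _ _ _ (m ++ (l ++ q))
        rw [← List.append_assoc]
        refine soundBy_append.2 ⟨Sound.mono (fun x hx => ?_) subset_rfl hl,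
          Sound.mono (fun x hx => ?_) (fun x hx => Or.inl hx) hq.2⟩
        · simp only [Set.mem_union, Set.mem_ofPred_eq, List.mem_append] at hx ⊢
          tauto
        · simp only [Set.mem_union, Set.mem_ofPred_eq, List.mem_cons, List.mem_append] at hx ⊢
          rcases hx with hx | rfl | hx
          exacts [Or.inl (hX hx), Or.inl he, Or.inr (Or.inr hx)]

/-! ### Prefixes of sequences -/

theorem mem_take_iff {σ : Stream'.Seq E} {n : ℕ} {x : E} :
    x ∈ σ.take n ↔ ∃ i < n, σ.get? i = some x := by
  rw [List.mem_iff_getElem?]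
  simp only [Stream'.Seq.getElem?_take]
  constructor
  · rintro ⟨i, hi⟩
    by_cases h : i < n
    · exact ⟨i, h, by simpa [h] using hi⟩
    · simp [h] at hi
  · rintro ⟨i, h, hi⟩
    exact ⟨i, by simpa [h] using hi⟩

theorem take_subset_take {σ : Stream'.Seq E} {m n : ℕ} (h : m ≤ n) :
    {x | x ∈ σ.take m} ⊆ {x | x ∈ σ.take n} := by
  intro x hx
  obtain ⟨i, hi, h'⟩ := mem_take_iff.1 hx
  exact mem_take_iff.2 ⟨i, hi.trans_le h, h'⟩

theorem take_subset_events (σ : Stream'.Seq E) (n : ℕ) : {x | x ∈ σ.take n} ⊆ events σ := by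
  intro x hx
  obtain ⟨i, -, h'⟩ := mem_take_iff.1 hx
  exact ⟨i, h'⟩

theorem take_take {σ : Stream'.Seq E} {m n : ℕ} (h : m ≤ n) :
    (σ.take n).take m = σ.take m := by
  ext1 i
  rw [List.getElem?_take, Stream'.Seq.getElem?_take, Stream'.Seq.getElem?_take]
  split_ifs <;> first | rfl | omega

theorem take_ofList (l : List E) (n : ℕ) : (Stream'.Seq.ofList l).take n = l.take n := by
  ext1 i
  rw [List.getElem?_take, Stream'.Seq.getElem?_take, Stream'.Seq.ofList_get?]

theorem eventually_subset_take {σ : Stream'.Seq E} {W : Set E} (hW : W.Finite)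
    (h : W ⊆ events σ) : ∀ᶠ k in Filter.atTop, W ⊆ {x | x ∈ σ.take k} := by
  have : ∀ x ∈ W, ∀ᶠ k in Filter.atTop, x ∈ σ.take k := by
    intro x hx
    obtain ⟨i, hi⟩ := h hx
    exact Filter.eventually_atTop.2 ⟨i + 1, fun k hk => mem_take_iff.2 ⟨i, by omega, hi⟩⟩
  filter_upwards [(Filter.eventually_all_finite hW).2 this] with k hk x hx using hk x hx

theorem exists_subset_take {σ : Stream'.Seq E} {W : Set E} (hW : W.Finite)
    (h : W ⊆ events σ) (n : ℕ) : ∃ k, n ≤ k ∧ W ⊆ {x | x ∈ σ.take k} := by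
  obtain ⟨k, h1, h2⟩ :=
    ((Filter.eventually_ge_atTop n).and (eventually_subset_take hW h)).exists
  exact ⟨k, h1, h2⟩

theorem IsPlay.nodup_take {ces : CES E} {σ : Stream'.Seq E} (h : IsPlay ces σ) (n : ℕ) :
    (σ.take n).Nodup := by
  rw [List.nodup_iff_getElem?_ne_getElem?]
  intro i j hij hj heq
  have hjn : j < n := hj.trans_le Stream'.Seq.length_take_le
  rw [Stream'.Seq.getElem?_take, Stream'.Seq.getElem?_take, if_pos (hij.trans hjn),
    if_pos hjn] at heq
  have : (σ.take n)[j]? = some (σ.take n)[j] := List.getElem?_eq_getElem hj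
  rw [Stream'.Seq.getElem?_take, if_pos hjn] at this
  exact hij.ne (h.1 _ _ _ (heq.trans this) this)

theorem IsPlay.isFinPlay_take {ces : CES E} {σ : Stream'.Seq E} (h : IsPlay ces σ) (n : ℕ) :
    IsFinPlay ces (σ.take n) :=
  ⟨h.nodup_take n, fun _ hx _ hy => h.2 _ (take_subset_events _ _ hx) _
    (take_subset_events _ _ hy)⟩

theorem IsPlay.notMem_take {ces : CES E} {σ : Stream'.Seq E} (h : IsPlay ces σ) {n : ℕ} {e : E}
    (he : σ.get? n = some e) : e ∉ σ.take n := by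
  intro hm
  obtain ⟨i, hi, h'⟩ := mem_take_iff.1 hm
  exact hi.ne (h.1 _ _ _ h' he)

/-! ### Event structures and their theories -/

section

variable {Δ : Set (HornClause E)} {ces : CES E}

theorem Corresponds.isFinPlay (h : Corresponds Δ ces) {l : List E} (hl : l.Nodup) :
    IsFinPlay ces l :=
  ⟨hl, fun _ _ _ _ => h.1 _ _⟩

theorem Corresponds.imp_mem_iff (h : Corresponds Δ ces) {X : Finset E} {e : E} :
    HornClause.imp X e ∈ Δ ↔ ces.enables X e := by
  rw [h.2]
  constructor
  · rintro (⟨Y, a, h1, h2⟩ | ⟨Y, a, h1, h2⟩)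
    · obtain ⟨rfl, rfl⟩ := HornClause.imp.inj h2; exact h1
    · cases h2
  · exact fun h => Or.inl ⟨X, e, h, rfl⟩

theorem Corresponds.cimp_mem_iff (h : Corresponds Δ ces) {X : Finset E} {e : E} :
    HornClause.cimp X e ∈ Δ ↔ ces.circEnables X e := by
  rw [h.2]
  constructor
  · rintro (⟨Y, a, h1, h2⟩ | ⟨Y, a, h1, h2⟩)
    · cases h2
    · obtain ⟨rfl, rfl⟩ := HornClause.cimp.inj h2; exact h1
  · exact fun h => Or.inr ⟨X, e, h, rfl⟩

theorem Corresponds.arr_iff (h : Corresponds Δ ces) {l : List E} {e : E} :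
    Arr Δ {x | x ∈ l} e ↔ ces.enables {x | x ∈ l} e := by
  constructor
  · rintro ⟨B, hB, hBl⟩
    exact ces.enables_saturated _ _ _ hBl l.finite_toSet (h.imp_mem_iff.1 hB)
      fun _ _ _ _ => h.1 _ _
  · intro he
    obtain ⟨s, hs⟩ := l.finite_toSet.exists_finset_coe
    rw [← hs] at he ⊢
    exact ⟨s, h.imp_mem_iff.2 he, subset_rfl⟩

theorem Corresponds.circ_iff (h : Corresponds Δ ces) {l : List E} {e : E} :
    Circ Δ {x | x ∈ l} e ↔ ces.circEnables {x | x ∈ l} e := by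
  constructor
  · rintro ⟨B, hB, hBl⟩
    exact ces.circEnables_saturated _ _ _ hBl l.finite_toSet (h.cimp_mem_iff.1 hB)
      fun _ _ _ _ => h.1 _ _
  · intro he
    obtain ⟨s, hs⟩ := l.finite_toSet.exists_finset_coe
    rw [← hs] at he ⊢
    exact ⟨s, h.cimp_mem_iff.2 he, subset_rfl⟩

theorem Corresponds.mem_enabledEvents (h : Corresponds Δ ces) {X Y : Set E} {e : E}
    (he : Arr Δ X e ∨ Circ Δ Y e) : e ∈ ces.enabledEvents := by
  rcases he with ⟨B, hB, -⟩ | ⟨B, hB, -⟩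
  · exact ⟨B, Or.inl (h.imp_mem_iff.1 hB)⟩
  · exact ⟨B, Or.inr (h.cimp_mem_iff.1 hB)⟩

theorem Corresponds.urgent_subset (h : Corresponds Δ ces) {X : Set E} :
    urgent Δ X ⊆ ces.enabledEvents := by
  intro e he
  obtain ⟨-, h1, l, hl⟩ := mem_urgent_iff.1 he
  exact h.mem_enabledEvents (hl.1.resolve_left h1)

theorem Corresponds.mem_credits_iff (h : Corresponds Δ ces) {l : List E} {e : E} :
    e ∈ credits ces l ↔
      ∃ i, l[i]? = some e ∧ ¬ Arr Δ {x | x ∈ l.take i} e ∧ ¬ Circ Δ {x | x ∈ l} e := by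
  simp only [h.arr_iff, h.circ_iff]; rfl

theorem Corresponds.mem_credits_take_iff (h : Corresponds Δ ces) {σ : Stream'.Seq E} {n : ℕ}
    {e : E} : e ∈ credits ces (σ.take n) ↔
      ∃ i < n, σ.get? i = some e ∧ ¬ Arr Δ {x | x ∈ σ.take i} e ∧
        ¬ Circ Δ {x | x ∈ σ.take n} e := by
  rw [h.mem_credits_iff]
  refine exists_congr fun i => ?_
  by_cases hi : i < n
  · rw [Stream'.Seq.getElem?_take, if_pos hi, take_take hi.le]; simp [hi]
  · simp [Stream'.Seq.getElem?_take, hi]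

/-! ### Sequences where all urgent events are fired -/

/-- All the events that are urgent at some point of the sequence occur in it. -/
def Live (Δ : Set (HornClause E)) (σ : Stream'.Seq E) : Prop :=
  ∀ i a, a ∈ urgent Δ {x | x ∈ σ.take i} → a ∈ events σ

theorem live_of_not_perpetual {σ : Stream'.Seq E}
    (h : ∀ a i, ∃ j, i ≤ j ∧ a ∉ urgent Δ {x | x ∈ σ.take j}) : Live Δ σ := by
  intro i a ha
  by_contra hn
  obtain ⟨j, hij, hj⟩ := h a i
  exact hj (urgent_mono ha (take_subset_take hij) (σ.take j).finite_toSet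
    fun h => hn (take_subset_events _ _ h))

/-- The head is either already fired or urgent, hence fired sooner or later; after that the tail is
justified from a longer prefix, and the argument repeats. -/
theorem Live.events_of_sound {σ : Stream'.Seq E} (hσ : Live Δ σ) {l : List E} : ∀ {i : ℕ},
    Sound Δ ({x | x ∈ σ.take i} ∪ {x | x ∈ l}) {x | x ∈ σ.take i} l →
    {x | x ∈ l} ⊆ events σ := by
  induction l with
  | nil => intro i _ x hx; cases hx
  | cons e l ih =>
    intro i h
    have he : e ∈ events σ := by
      by_cases hi : e ∈ σ.take i
      · exact take_subset_events _ _ hi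
      · exact hσ i e (mem_urgent_iff.2 ⟨(σ.take i).finite_toSet, hi, l, h⟩)
    obtain ⟨j, hij, hj⟩ := exists_subset_take (Set.finite_singleton e)
      (Set.singleton_subset_iff.2 he) i
    rw [Set.singleton_subset_iff] at hj
    have h' : Sound Δ ({x | x ∈ σ.take j} ∪ {x | x ∈ l}) {x | x ∈ σ.take j} l := by
      refine Sound.mono ?_ (Set.insert_subset hj (take_subset_take hij)) h.2
      rintro x (hx | hx)
      · exact Or.inl (take_subset_take hij hx)
      · rcases List.mem_cons.1 hx with rfl | hx
        · exact Or.inl hj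
        · exact Or.inr hx
    intro x hx
    rcases List.mem_cons.1 hx with rfl | hx
    · exact he
    · exact ih h' hx

/-- The event occurs in the sequence, and follows from the events before it by an implication
or from all the events of the sequence by a contractual implication. -/
def Settled (Δ : Set (HornClause E)) (σ : Stream'.Seq E) (e : E) : Prop :=
  ∃ i, σ.get? i = some e ∧ (Arr Δ {x | x ∈ σ.take i} e ∨ Circ Δ (events σ) e)

theorem Live.settled {σ : Stream'.Seq E} (hσ : Live Δ σ) {i : ℕ} {e : E}
    (he : σ.get? i = some e) (hu : e ∈ urgent Δ {x | x ∈ σ.take i}) : Settled Δ σ e := by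
  obtain ⟨-, h1, l, hl⟩ := mem_urgent_iff.1 hu
  refine ⟨i, he, (hl.1.resolve_left h1).imp_right fun h => h.mono ?_⟩
  exact Set.union_subset (take_subset_events _ _) (hσ.events_of_sound hl)

/-- The body of a contractual clause is finite, so a finite prefix already contains it. -/
theorem Settled.eventually {σ : Stream'.Seq E} {e : E} (h : Settled Δ σ e) :
    ∀ᶠ k in Filter.atTop, ∃ i < k, σ.get? i = some e ∧
      (Arr Δ {x | x ∈ σ.take i} e ∨ Circ Δ {x | x ∈ σ.take k} e) := by
  obtain ⟨i, hi, h | ⟨B, hB, h⟩⟩ := h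
  · filter_upwards [Filter.eventually_gt_atTop i] with k hk using ⟨i, hk, hi, Or.inl h⟩
  · filter_upwards [Filter.eventually_gt_atTop i, eventually_subset_take B.finite_toSet h]
      with k hk hB' using ⟨i, hk, hi, Or.inr ⟨B, hB, hB'⟩⟩

theorem Settled.eventually_notMem_credits (hΔ : Corresponds Δ ces) {σ : Stream'.Seq E}
    (hp : IsPlay ces σ) {e : E} (h : Settled Δ σ e) :
    ∀ᶠ k in Filter.atTop, e ∉ credits ces (σ.take k) := by
  filter_upwards [h.eventually] with k hk hc
  obtain ⟨i, -, hi, h1⟩ := hk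
  obtain ⟨j, -, hj, h2, h3⟩ := hΔ.mem_credits_take_iff.1 hc
  obtain rfl := hp.1 _ _ _ hi hj
  exact h1.elim h2 h3

theorem settled_of_notMem_credits (hΔ : Corresponds Δ ces) {σ : Stream'.Seq E} {i j : ℕ} {e : E}
    (hi : σ.get? i = some e) (hij : i < j) (h : e ∉ credits ces (σ.take j)) :
    Settled Δ σ e := by
  by_contra hn
  refine h (hΔ.mem_credits_take_iff.2 ⟨i, hij, hi, fun h => hn ⟨i, hi, Or.inl h⟩, fun h =>
    hn ⟨i, hi, Or.inr (h.mono (take_subset_events _ _))⟩⟩)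

theorem Settled.mem_enabledEvents (hΔ : Corresponds Δ ces) {σ : Stream'.Seq E} {e : E}
    (h : Settled Δ σ e) : e ∈ ces.enabledEvents := by
  obtain ⟨i, -, h⟩ := h
  exact hΔ.mem_enabledEvents h

/-- A long enough prefix of `η` contains `W` together with the justifications of its elements, and
its other entries already occur in a prefix of `σ`. So this prefix of `η` is a justified list from a
prefix of `σ`, and liveness fires all of it. -/
theorem Live.subset_events_of_settled {σ η : Stream'.Seq E} (hσ : Live Δ σ)
    (hη : IsPlay ces η) {W : Set E} (hW : W.Finite) (hset : ∀ e ∈ W, Settled Δ η e)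
    (hsub : events η \ W ⊆ events σ) : W ⊆ events σ := by
  obtain ⟨K, hK⟩ := ((Filter.eventually_all_finite hW).2 fun e he =>
    (hset e he).eventually).exists
  obtain ⟨j, -, hj⟩ := exists_subset_take (σ := σ) (W := {x | x ∈ η.take K} \ W)
    ((η.take K).finite_toSet.subset Set.sdiff_subset)
    (fun x hx => hsub ⟨take_subset_events _ _ hx.1, hx.2⟩) 0
  have h : Sound Δ ({x | x ∈ σ.take j} ∪ {x | x ∈ η.take K}) {x | x ∈ σ.take j} (η.take K) := by
    refine soundBy_of_getElem? fun i e he => ?_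
    by_cases heW : e ∈ W
    · obtain ⟨i', hi', he', h⟩ := hK e heW
      have hiK : i < K := by
        by_contra hn
        simp [Stream'.Seq.getElem?_take, hn] at he
      rw [Stream'.Seq.getElem?_take, if_pos hiK] at he
      obtain rfl := hη.1 _ _ _ he he'
      rw [take_take hiK.le]
      exact Or.inr (h.imp (·.mono Set.subset_union_right) (·.mono Set.subset_union_right))
    · exact Or.inl (Or.inl (hj ⟨List.mem_of_getElem? he, heW⟩))
  intro e he
  obtain ⟨i, hi, he', -⟩ := hK e he
  exact hσ.events_of_sound h (mem_take_iff.2 ⟨i, hi, he'⟩)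

/-! ### Urgent events are prudent -/

variable {owner : E → Part} {A : Part}

theorem isStrategy_urgentStrategy (hΔ : Corresponds Δ ces) :
    IsStrategy ces owner A (urgentStrategy Δ owner A) := by
  rintro σ hσ e ⟨he, hA⟩
  refine ⟨hA, hΔ.isFinPlay ?_⟩
  have := he.1
  exact List.nodup_append.2 ⟨hσ.1, List.nodup_singleton _, by
    rintro a ha b hb rfl; rw [List.mem_singleton.1 hb] at ha; exact this ha⟩

/-- An event of `A` cannot stay urgent forever by fairness, an event of another participant by
innocence. Agreement of `S` with the urgent strategy matters only from length `n` on; `hlen` ensures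
that the later prefixes are that long. -/
theorem live_of_fair {σ : Stream'.Seq E} {S : List E → Set E} {n : ℕ}
    {P : List E → E → Prop}
    (hP : ∀ σ e, IsFinPlay ces σ → e ∈ urgent Δ {x | x ∈ σ} → P σ e)
    (hS : ∀ τ : List E, n ≤ τ.length → S τ = urgentStrategy Δ owner A τ)
    (hlen : (σ.take n).length = n)
    (hp : IsPlay ces σ) (hf : Fair S σ) (hinn : ∀ B, B ≠ A → InnocentRel owner P B σ) :
    Live Δ σ := by
  apply live_of_not_perpetual
  intro a i
  by_cases ha : owner a = A
  · by_contra! hn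
    obtain ⟨h, hh, hfire⟩ := hf (max i n) a fun j hj => by
      have hlen' : n ≤ (σ.take j).length := by
        have := congrArg List.length (take_take (σ := σ) ((le_max_right i n).trans hj))
        rw [List.length_take, hlen] at this
        omega
      rw [hS _ hlen']
      exact ⟨hn j ((le_max_left _ _).trans hj), ha⟩
    have h1 : i ≤ h + 1 := by omega
    exact (hn (h + 1) h1).1 (mem_take_iff.2 ⟨h, by omega, hfire⟩)
  · obtain ⟨j, hij, hj⟩ := hinn _ ha a rfl i
    exact ⟨j, hij, fun h => hj (hP _ _ (hp.isFinPlay_take _) h)⟩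

theorem length_take_of_take_eq {σ : Stream'.Seq E} {l : List E} (h : σ.take l.length = l) :
    (σ.take l.length).length = l.length := by rw [h]

theorem length_le_of_get? {σ : Stream'.Seq E} {i : ℕ} {e : E} (h : σ.get? i = some e) :
    i ≤ (σ.take i).length := by
  by_contra! hn
  have h1 : (σ.take (i + 1))[i]? = some e := by
    rw [Stream'.Seq.getElem?_take, if_pos (by omega), h]
  have h2 := (List.getElem?_eq_some_iff.1 h1).1
  have h3 := congrArg List.length (take_take (σ := σ) (Nat.le_add_right i 1))
  rw [List.length_take] at h3
  omega

/-- Stated for any `P` containing urgency, so that it serves both as the coinduction step, with `P`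
being urgency itself, and afterwards with `P` being prudence. -/
theorem prudentWithPastRel_of_eq_urgentStrategy (hΔ : Corresponds Δ ces)
    (hfin : ces.enabledEvents.Finite) {P : List E → E → Prop}
    (hP : ∀ σ e, IsFinPlay ces σ → e ∈ urgent Δ {x | x ∈ σ} → P σ e)
    {S : List E → Set E} {σ : List E} (hstr : IsStrategy ces owner A S)
    (hσ : IsFinPlay ces σ) (hconf : Conforms owner A S (Stream'.Seq.ofList σ))
    (hS : ∀ τ : List E, σ.length ≤ τ.length → S τ = urgentStrategy Δ owner A τ) :
    PrudentWithPastRel ces owner P A S σ := by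
  refine ⟨hstr, hσ, hconf, fun σ' hp ht hf hc hinn => ?_⟩
  have hlive : Live Δ σ' := live_of_fair hP hS (length_take_of_take_eq ht) hp hf hinn
  have hurg : ∀ i e, σ.length ≤ i → σ'.get? i = some e → owner e = A →
      e ∈ urgent Δ {x | x ∈ σ'.take i} := by
    intro i e hi he hA
    have h := hc i e he hA
    rw [hS _ (hi.trans (length_le_of_get? he))] at h
    exact h.1
  set W := {e | owner e = A ∧ ∃ i, σ.length ≤ i ∧ σ'.get? i = some e}
  have hW : W.Finite := hfin.subset (by
    rintro e ⟨hA, i, hi, he⟩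
    exact hΔ.urgent_subset (hurg i e hi he hA))
  have hset : ∀ e ∈ W, ∀ᶠ k in Filter.atTop, e ∉ credits ces (σ'.take k) := by
    rintro e ⟨hA, i, hi, he⟩
    exact (hlive.settled he (hurg i e hi he hA)).eventually_notMem_credits hΔ hp
  obtain ⟨k, hk, hk'⟩ := ((Filter.eventually_gt_atTop σ.length).and
    ((Filter.eventually_all_finite hW).2 hset)).exists
  refine ⟨k, hk, ?_⟩
  rintro e ⟨he, hA⟩
  obtain ⟨i, hik, hi, h1, h2⟩ := hΔ.mem_credits_take_iff.1 he
  -- A credit left from the past was already a credit in `σ`, since fewer events cannot honour more;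
  -- the later moves all lie in `W`.
  by_cases hiσ : i < σ.length
  · rw [← ht]
    exact hΔ.mem_credits_take_iff.2 ⟨i, hiσ, hi, h1, fun h =>
      h2 (h.mono (take_subset_take hk.le))⟩
  · exact absurd he (hk' e ⟨hA, i, not_lt.1 hiσ, hi⟩)

theorem prudentEvent_of_urgent (hΔ : Corresponds Δ ces) (hfin : ces.enabledEvents.Finite)
    {σ : List E} {e : E} (hσ : IsFinPlay ces σ) (he : e ∈ urgent Δ {x | x ∈ σ}) :
    PrudentEvent ces owner σ e := by
  classical
  have hle : (fun σ e => IsFinPlay ces σ ∧ e ∈ urgent Δ {x | x ∈ σ}) ≤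
      PrudentEvent ces owner := by
    apply OrderHom.le_gfp
    rintro σ e ⟨hσ, he⟩
    -- Below the length of `σ` every legal move of the owner is allowed, so that `σ` conforms to
    -- `S`.
    let S : List E → Set E := fun τ =>
      if σ.length ≤ τ.length then urgentStrategy Δ owner (owner e) τ
      else {x | owner x = owner e ∧ IsFinPlay ces (τ ++ [x])}
    have hstr : IsStrategy ces owner (owner e) S := by
      intro τ hτ x hx
      by_cases h : σ.length ≤ τ.length
      · simp only [S, if_pos h] at hx
        exact isStrategy_urgentStrategy hΔ τ hτ x hx
      · simp only [S, if_neg h] at hx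
        exact hx
    refine ⟨S, prudentWithPastRel_of_eq_urgentStrategy hΔ hfin (fun _ _ h h' => ⟨h, h'⟩) hstr hσ
      ?_ fun τ hτ => if_pos hτ, ?_⟩
    · intro i x hx hA
      rw [Stream'.Seq.ofList_get?] at hx
      obtain ⟨hi, hx'⟩ := List.getElem?_eq_some_iff.1 hx
      rw [take_ofList]
      have : ¬ σ.length ≤ (σ.take i).length := by rw [List.length_take]; omega
      simp only [S, if_neg this]
      refine ⟨hA, hΔ.isFinPlay ?_⟩
      rw [← hx', List.take_append_getElem]
      exact hσ.1.sublist (List.take_sublist _ _)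
    · simp only [S, if_pos le_rfl]
      exact ⟨he, rfl⟩
  exact hle σ e ⟨hσ, he⟩

theorem isPrudentStrategy_urgentStrategy (hΔ : Corresponds Δ ces)
    (hfin : ces.enabledEvents.Finite) :
    IsPrudentStrategy ces owner A (urgentStrategy Δ owner A) :=
  ⟨isStrategy_urgentStrategy hΔ, fun _ hσ hc =>
    prudentWithPastRel_of_eq_urgentStrategy hΔ hfin
      (fun _ _ h h' => prudentEvent_of_urgent hΔ hfin h h') (isStrategy_urgentStrategy hΔ) hσ hc
      fun _ _ => rfl⟩

end

/-! ### Schedules -/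

theorem take_succ_eq {σ : Stream'.Seq E} {n : ℕ} {l : List E} (hl : l.length ≤ n)
    (h : σ.take n = l) : σ.take (n + 1) = l ++ (σ.get? n).toList := by
  subst h
  cases hn : σ.get? n with
  | none =>
    ext1 i
    simp only [Option.toList_none, List.append_nil, Stream'.Seq.getElem?_take]
    by_cases h1 : i < n
    · simp [h1, h1.trans (Nat.lt_succ_self n)]
    · rw [if_neg h1]
      split_ifs with h2
      · obtain rfl : i = n := by omega
        exact hn
      · rfl
  | some e =>
    have hlen : (σ.take n).length = n := le_antisymm hl (length_le_of_get? hn)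
    ext1 i
    rw [Stream'.Seq.getElem?_take, Option.toList_some]
    rcases lt_trichotomy i n with h1 | rfl | h1
    · rw [List.getElem?_append_left (by omega), Stream'.Seq.getElem?_take, if_pos h1,
        if_pos (by omega)]
    · rw [List.getElem?_append_right (by omega), hlen, if_pos (by omega), hn]; simp
    · rw [List.getElem?_append_right (by omega), hlen, if_neg (by omega),
        List.getElem?_eq_none (by simp; omega)]

/-- A sequence can be built by repeatedly choosing an available event, until none is left. -/
theorem exists_seq_of_choice (f : List E → Option E) :
    ∃ σ : Stream'.Seq E, ∀ n, σ.get? n = f (σ.take n) := by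
  let L : ℕ → List E := fun n => Nat.rec [] (fun _ l => l ++ (f l).toList) n
  have hL : ∀ n, L (n + 1) = L n ++ (f (L n)).toList := fun _ => rfl
  have hlen : ∀ n, (L n).length ≤ n := by
    intro n
    induction n with
    | zero => rfl
    | succ n ih =>
      rw [hL, List.length_append]
      have : (f (L n)).toList.length ≤ 1 := by cases f (L n) <;> simp
      omega
  let σ : Stream'.Seq E := ⟨fun n => f (L n), by
    intro n hn
    change f (L n) = none at hn
    change f (L (n + 1)) = none
    rw [hL, hn]; simpa using hn⟩
  have hget : ∀ n, σ.get? n = f (L n) := fun _ => rfl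
  have htake : ∀ n, σ.take n = L n := by
    intro n
    induction n with
    | zero => rfl
    | succ n ih => rw [take_succ_eq (hlen n) ih, hget, hL]
  exact ⟨σ, fun n => by rw [hget, htake]⟩

/-- Choosing the available event of least code, no event remains available forever. -/
theorem exists_seq_not_perpetual [Countable E] (G : List E → Set E)
    (hG : ∀ l, ∀ e ∈ G l, e ∉ l) :
    ∃ σ : Stream'.Seq E, (∀ n e, σ.get? n = some e → e ∈ G (σ.take n)) ∧
      ∀ e i, ∃ j, i ≤ j ∧ e ∉ G (σ.take j) := by
  classical
  rcases isEmpty_or_nonempty E with hE | hE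
  · exact ⟨Stream'.Seq.nil, fun _ e => isEmptyElim e, fun e => isEmptyElim e⟩
  obtain ⟨code, hcode⟩ := exists_injective_nat E
  have hmin : ∀ l, (G l).Nonempty → ∃ e ∈ G l, ∀ x ∈ G l, code e ≤ code x := by
    intro l hl
    obtain ⟨e, he, h⟩ := WellFounded.has_min (InvImage.wf code Nat.lt_wfRel.wf) (G l) hl
    exact ⟨e, he, fun x hx => not_lt.1 (h x hx)⟩
  choose! p hp hp' using hmin
  obtain ⟨σ, hσ⟩ := exists_seq_of_choice fun l => if (G l).Nonempty then some (p l) else none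
  have hmem : ∀ n e, σ.get? n = some e → e ∈ G (σ.take n) := by
    intro n e he
    rw [hσ] at he
    split_ifs at he with h
    exact Option.some.inj he ▸ hp _ h
  refine ⟨σ, hmem, fun e i => ?_⟩
  by_contra! hn
  have hfire : ∀ j, σ.get? (i + j) = some (p (σ.take (i + j))) := fun j => by
    rw [hσ, if_pos ⟨e, hn _ (by omega)⟩]
  -- If `e` stayed available from `i` on, infinitely many distinct events of code at most that of
  -- `e` would be fired.
  have hinj : Function.Injective fun j => code (p (σ.take (i + j))) := by
    have key : ∀ j k, j < k → p (σ.take (i + j)) ≠ p (σ.take (i + k)) := by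
      intro j k hjk heq
      refine hG _ _ (hmem _ _ (hfire k)) (mem_take_iff.2 ⟨i + j, by omega, ?_⟩)
      rw [hfire, heq]
    intro j k hjk
    rcases lt_trichotomy j k with h | h | h
    · exact absurd (hcode hjk) (key _ _ h)
    · exact h
    · exact absurd (hcode hjk).symm (key _ _ h)
  have hbound : ∀ j, code (p (σ.take (i + j))) ≤ code e := fun j =>
    hp' _ ⟨e, hn _ (by omega)⟩ _ (hn _ (by omega))
  exact Set.infinite_range_of_injective hinj
    ((Set.finite_Iic (code e)).subset (by rintro _ ⟨j, rfl⟩; exact hbound j))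

theorem exists_play_not_perpetual [Countable E] {Δ : Set (HornClause E)} {ces : CES E}
    (hΔ : Corresponds Δ ces) {l : List E} (hl : l.Nodup)
    (G : List E → Set E) (hG : ∀ τ, IsFinPlay ces τ → ∀ e ∈ G τ, e ∉ τ) :
    ∃ σ : Stream'.Seq E, IsPlay ces σ ∧ σ.take l.length = l ∧
      (∀ n e, l.length ≤ n → σ.get? n = some e → e ∈ G (σ.take n)) ∧
      ∀ e i, ∃ j, i ≤ j ∧ e ∉ G (σ.take j) := by
  classical
  -- The choice is forced to spell out `l` before `G` takes over. The sequence cannot stop earlier,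
  -- as the next letter of `l` would remain available forever.
  obtain ⟨σ, h1, h2⟩ := exists_seq_not_perpetual (fun τ => {e | e ∉ τ ∧
    if τ.length < l.length then l[τ.length]? = some e else e ∈ G τ}) fun _ _ h => h.1
  have hplay : IsPlay ces σ := by
    refine ⟨?_, fun _ _ _ _ => hΔ.1 _ _⟩
    have key : ∀ i j e, i < j → σ.get? i = some e → σ.get? j = some e → False :=
      fun i j e hij hi hj => (h1 j e hj).1 (mem_take_iff.2 ⟨i, hij, hi⟩)
    intro i j e hi hj
    rcases lt_trichotomy i j with h | h | h
    · exact (key _ _ _ h hi hj).elim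
    · exact h
    · exact (key _ _ _ h hj hi).elim
  have htake : ∀ n ≤ l.length, σ.take n = l.take n := by
    intro n
    induction n with
    | zero => intro; rfl
    | succ n ih =>
      intro hn
      have ih' := ih (by omega)
      have hlen : (σ.take n).length = n := by rw [ih', List.length_take]; omega
      have hln : l[n]? = some l[n] := List.getElem?_eq_getElem (by omega)
      have hfresh : l[n] ∉ l.take n := by
        intro hm
        obtain ⟨i, hi, h⟩ := List.getElem_of_mem hm
        rw [List.getElem_take] at h
        have := (List.Nodup.getElem_inj_iff hl).1 h
        rw [List.length_take] at hi
        omega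
      have hget : σ.get? n = some l[n] := by
        cases hg : σ.get? n with
        | some e =>
          have h := (h1 n e hg).2
          simp only [hlen, if_pos (show n < l.length by omega)] at h
          rw [← h, hln]
        | none =>
          exfalso
          obtain ⟨j, hj, hj'⟩ := h2 l[n] n
          have hstuck : σ.take j = σ.take n := by
            ext1 i
            rw [Stream'.Seq.getElem?_take, Stream'.Seq.getElem?_take]
            by_cases hi : i < n
            · rw [if_pos hi, if_pos (by omega)]
            · rw [if_neg hi, Stream'.Seq.le_stable σ (not_lt.1 hi) hg]; simp
          rw [hstuck] at hj'
          refine hj' ⟨by rwa [ih'], ?_⟩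
          simp only [hlen, if_pos (show n < l.length by omega)]
          exact hln
      rw [take_succ_eq hlen.le rfl, hget, ih', Option.toList_some, List.take_append_getElem]
  have htl : σ.take l.length = l := by rw [htake _ le_rfl, List.take_length]
  have hlong : ∀ n, l.length ≤ n → l.length ≤ (σ.take n).length := by
    intro n hn
    have := congrArg List.length (take_take (σ := σ) hn)
    rw [List.length_take, htl] at this
    omega
  refine ⟨σ, hplay, htl, fun n e hn he => ?_, fun e i => ?_⟩
  · have h := (h1 n e he).2
    rwa [if_neg (not_lt.2 (hlong n hn))] at h
  · obtain ⟨j, hj, h⟩ := h2 e (max i l.length)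
    refine ⟨j, (le_max_left _ _).trans hj, fun hG' => h ⟨hG _ (hplay.isFinPlay_take j) e hG', ?_⟩⟩
    rwa [if_neg (not_lt.2 (hlong j ((le_max_right _ _).trans hj)))]

/-! ### Prudent events are urgent -/

section

variable {Δ : Set (HornClause E)} {ces : CES E} {owner : E → Part} {A : Part}

theorem PrudentEvent.notMem {σ : List E} {e : E} (h : PrudentEvent ces owner σ e) : e ∉ σ := by
  obtain ⟨S, ⟨hS, hσ, -⟩, he⟩ := (prudentEvent_iff _ _ _ _).1 h
  intro hm
  exact (List.nodup_append.1 (hS σ hσ e he).2.1).2.2 e hm e (List.mem_singleton_self e) rfl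

theorem IsStrategy.notMem {S : List E → Set E} (hS : IsStrategy ces owner A S) {σ : List E}
    (hσ : IsFinPlay ces σ) {e : E} (he : e ∈ S σ) : e ∉ σ := fun hm =>
  (List.nodup_append.1 (hS σ hσ e he).2.1).2.2 e hm e (List.mem_singleton_self e) rfl

theorem urgent_of_prudentEvent [Countable E] (hΔ : Corresponds Δ ces)
    (hfin : ces.enabledEvents.Finite) {σ : List E} {e : E} (h : PrudentEvent ces owner σ e) :
    e ∈ urgent Δ {x | x ∈ σ} := by
  induction hn : (ces.enabledEvents \ {x | x ∈ σ}).ncard using Nat.strong_induction_on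
    generalizing σ e with
  | _ n ih =>
  subst hn
  obtain ⟨S, ⟨hS, hσ, hc, hprud⟩, he⟩ := (prudentEvent_iff _ _ _ _).1 h
  have heσ := h.notMem
  -- This schedule is fair to `S` and makes all the opponents innocent, so prudence of `S` applies
  -- to it.
  obtain ⟨σ', hp, ht, hG, hnp⟩ := exists_play_not_perpetual hΔ (l := σ ++ [e])
    (hS σ hσ e he).2.1 (fun τ => S τ ∪ {b | owner b ≠ owner e ∧ PrudentEvent ces owner τ b}) (by
      rintro τ hτ b (hb | hb)
      · exact hS.notMem hτ hb
      · exact hb.2.notMem)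
  have hlen : (σ ++ [e]).length = σ.length + 1 := by simp
  rw [hlen] at ht hG
  have htσ : ∀ i ≤ σ.length, σ'.take i = σ.take i := by
    intro i hi
    rw [← take_take (show i ≤ σ.length + 1 by omega), ht, List.take_append_of_le_length hi]
  have hget : ∀ i ≤ σ.length, σ'.get? i = (σ ++ [e])[i]? := by
    intro i hi
    rw [← ht, Stream'.Seq.getElem?_take, if_pos (by omega)]
  have hge : σ'.get? σ.length = some e := by rw [hget _ le_rfl]; simp
  have hts : σ'.take σ.length = σ := by rw [htσ _ le_rfl, List.take_length]
  have hconf : Conforms owner (owner e) S σ' := by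
    intro i x hx hA
    rcases lt_trichotomy i σ.length with hi | rfl | hi
    · have h1 := hc i x (by
        rw [Stream'.Seq.ofList_get?, ← hx, hget _ hi.le, List.getElem?_append_left hi]) hA
      rwa [take_ofList, ← htσ _ hi.le] at h1
    · rw [hge] at hx
      obtain rfl := Option.some.inj hx
      rwa [hts]
    · exact (hG i x hi hx).resolve_right fun h => h.1 hA
  have hfair : Fair S σ' := by
    intro i x hx
    obtain ⟨j, hij, hj⟩ := hnp x i
    exact absurd (Or.inl (hx j hij)) hj
  have hinn : ∀ B, B ≠ owner e → InnocentRel owner (PrudentEvent ces owner) B σ' := by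
    rintro B hB x rfl i
    obtain ⟨j, hij, hj⟩ := hnp x i
    exact ⟨j, hij, fun h => hj (Or.inr ⟨hB, h⟩)⟩
  obtain ⟨k, hk, hcr⟩ := hprud σ' hp hts hfair hconf hinn
  have hjust : ∀ i x, σ.length ≤ i → i < k → σ'.get? i = some x → owner x = owner e →
      Arr Δ {y | y ∈ σ'.take i} x ∨ Circ Δ {y | y ∈ σ'.take k} x := by
    intro i x hi hik hx hA
    by_contra! hn
    have h1 := hcr ⟨hΔ.mem_credits_take_iff.2 ⟨i, hik, hx, hn.1, hn.2⟩, hA⟩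
    obtain ⟨i', h2, -⟩ := h1
    have h3 := List.mem_of_getElem? h2
    rw [← hts] at h3
    exact hp.notMem_take hx (take_subset_take hi h3)
  have heF : e ∈ ces.enabledEvents := hΔ.mem_enabledEvents (hjust _ _ le_rfl hk hge rfl)
  -- Past `σ`, the event `e` has been fired and it is an enabled event, so the induction measure has
  -- dropped.
  have hsmall : ∀ i b, σ.length < i → PrudentEvent ces owner (σ'.take i) b →
      b ∈ urgent Δ {x | x ∈ σ'.take i} := by
    intro i b hi hb
    refine ih _ (Set.ncard_lt_ncard ?_ (hfin.subset Set.sdiff_subset)) hb rfl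
    have hsub : {x | x ∈ σ} ⊆ {x | x ∈ σ'.take i} := by
      rw [← hts]; exact take_subset_take hi.le
    exact (Set.ssubset_iff_of_subset (Set.sdiff_subset_sdiff_right hsub)).2
      ⟨e, ⟨heF, heσ⟩, fun h => h.2 (mem_take_iff.2 ⟨_, hi, hge⟩)⟩
  obtain ⟨m, hm⟩ : ∃ m, σ'.take k = σ ++ e :: m := by
    refine ⟨(σ'.take k).drop (σ.length + 1), ?_⟩
    conv_lhs => rw [← List.take_append_drop (σ.length + 1) (σ'.take k)]
    rw [take_take (by omega), ht]; simp
  -- Moves of the owner of `e` are justified within the stage `k`, and those of the opponents are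
  -- urgent when fired.
  have hs : SoundBy (fun X x => Just Δ {y | y ∈ σ'.take k} X x ∨ x ∈ urgent Δ X)
      {x | x ∈ σ} (e :: m) := by
    refine soundBy_of_getElem? fun i x hx => ?_
    have hx' : (σ'.take k)[σ.length + i]? = some x := by
      rw [hm, List.getElem?_append_right (by omega)]; simpa using hx
    have hik : σ.length + i < k := by
      by_contra hn
      simp [Stream'.Seq.getElem?_take, hn] at hx'
    rw [Stream'.Seq.getElem?_take, if_pos hik] at hx'
    have hpre : {y | y ∈ σ} ∪ {y | y ∈ (e :: m).take i} = {y | y ∈ σ'.take (σ.length + i)} := by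
      rw [← take_take hik.le, hm, List.take_length_add_append]
      ext y; simp
    rw [hpre]
    by_cases hA : owner x = owner e
    · exact Or.inl (Or.inr (hjust _ _ (by omega) hik hx' hA))
    · have hi : σ.length < σ.length + i := by
        rcases Nat.eq_zero_or_pos i with rfl | hi
        · rw [Nat.add_zero, hge] at hx'
          exact absurd (congrArg owner (Option.some.inj hx')).symm hA
        · omega
      rcases hG _ _ hi hx' with h1 | h1
      · exact absurd (hS _ (hp.isFinPlay_take _) _ h1).1 hA
      · exact Or.inr (hsmall _ _ hi h1.2)
  have hsub : {x | x ∈ σ} ⊆ {y | y ∈ σ'.take k} := by rw [hm]; intro x hx; simp_all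
  have hsub' : {x | x ∈ e :: m} ⊆ {y | y ∈ σ'.take k} := by
    rw [hm]; exact fun x hx => List.mem_append_right _ hx
  obtain ⟨l, hl⟩ := exists_sound_of_urgent (fun _ _ h => h) hsub hsub' hs
  refine mem_urgent_iff.2 ⟨σ.finite_toSet, heσ, m ++ l, Sound.mono ?_ subset_rfl hl⟩
  rw [hm]
  intro x hx
  simp only [Set.mem_union, Set.mem_ofPred_eq, List.mem_append, List.mem_cons] at hx ⊢
  tauto

/-! ### Urgent strategies win -/

theorem live_of_innocent (hΔ : Corresponds Δ ces) (hfin : ces.enabledEvents.Finite)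
    {σ : Stream'.Seq E} (hp : IsPlay ces σ) (h : ∀ B, Innocent ces owner B σ) : Live Δ σ := by
  apply live_of_not_perpetual
  intro a i
  obtain ⟨j, hij, hj⟩ := h _ a rfl i
  exact ⟨j, hij, fun h => hj (prudentEvent_of_urgent hΔ hfin (hp.isFinPlay_take _) h)⟩

/-- An event prudent forever would be urgent forever, hence fired by fairness; but a fired event is
no longer urgent. -/
theorem innocent_of_fair [Countable E] (hΔ : Corresponds Δ ces)
    (hfin : ces.enabledEvents.Finite) {σ : Stream'.Seq E}
    (hf : Fair (urgentStrategy Δ owner A) σ) : Innocent ces owner A σ := by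
  intro e he i
  by_contra! hn
  have hu : ∀ j, i ≤ j → e ∈ urgentStrategy Δ owner A (σ.take j) := fun j hj =>
    ⟨urgent_of_prudentEvent hΔ hfin (hn j hj), he⟩
  obtain ⟨h, hih, hh⟩ := hf i e hu
  exact (hu (h + 1) (by omega)).1.1 (mem_take_iff.2 ⟨h, by omega, hh⟩)

theorem creditFree_of_settled (hΔ : Corresponds Δ ces) {σ : Stream'.Seq E} (hp : IsPlay ces σ)
    (h : ∀ e ∈ events σ, owner e = A → Settled Δ σ e) : CreditFree ces owner A σ := by
  intro e he i
  by_cases hσ : e ∈ events σ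
  · obtain ⟨j, h1, h2⟩ := ((Filter.eventually_ge_atTop i).and
      ((h e hσ he).eventually_notMem_credits hΔ hp)).exists
    exact ⟨j, h1, h2⟩
  · refine ⟨i, le_rfl, fun hc => hσ ?_⟩
    obtain ⟨j, -, hj, -⟩ := hΔ.mem_credits_take_iff.1 hc
    exact ⟨j, hj⟩

theorem CreditFree.settled (hΔ : Corresponds Δ ces) {σ : Stream'.Seq E}
    (h : CreditFree ces owner A σ) {e : E} (he : e ∈ events σ) (hA : owner e = A) :
    Settled Δ σ e := by
  obtain ⟨i, hi⟩ := he
  obtain ⟨j, hij, hj⟩ := h e hA (i + 1)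
  exact settled_of_notMem_credits hΔ hi hij hj

/-- If `A` has a winning strategy, then the others can reproduce against it the events of a live
play where all the events of `A` are settled, so that the payoff of `A` is positive. -/
theorem exists_win_of_live [Countable E] {C : Contract E Part} (hΔ : Corresponds Δ C.ces)
    (hfin : C.ces.enabledEvents.Finite) {S : List E → Set E}
    (hS : IsWinningStrategy C owner A S) {σ : Stream'.Seq E} (hp : IsPlay C.ces σ)
    (hlive : Live Δ σ) (hset : ∀ e ∈ events σ, owner e = A → Settled Δ σ e) :
    ∃ η ∈ C.payoff A, events η = events σ := by
  -- Besides their events of `σ`, the opponents also play their prudent events: this keeps them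
  -- innocent, so `S` cannot win by someone else's culpability.
  obtain ⟨η, hη, -, hG, hnp⟩ := exists_play_not_perpetual hΔ (l := []) List.nodup_nil
    (fun τ => S τ ∪ {b | b ∉ τ ∧ owner b ≠ A ∧ (b ∈ events σ ∨ PrudentEvent C.ces owner τ b)}) (by
      rintro τ hτ b (hb | hb)
      · exact hS.1.notMem hτ hb
      · exact hb.1)
  have hconf : Conforms owner A S η := fun i x hx hA =>
    (hG i x (Nat.zero_le _) hx).resolve_right fun h => h.2.1 hA
  have hfair : Fair S η := by
    intro i x hx
    obtain ⟨j, hij, hj⟩ := hnp x i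
    exact absurd (Or.inl (hx j hij)) hj
  have hinn : ∀ B, B ≠ A → Innocent C.ces owner B η := by
    rintro B hB x rfl i
    obtain ⟨j, hij, hj⟩ := hnp x i
    exact ⟨j, hij, fun h => hj (Or.inr ⟨h.notMem, hB, Or.inr h⟩)⟩
  rcases hS.2 η hη hfair hconf with ⟨hpay, hcf, hinn'⟩ | ⟨-, B, hB, hB'⟩
  swap
  · exact absurd (hinn B hB) hB'
  have hliveη : Live Δ η := live_of_innocent hΔ hfin hη hinn'
  have hN : ∀ e ∈ events σ, owner e ≠ A → e ∈ events η := by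
    intro e he hA
    by_contra hn
    obtain ⟨j, -, hj⟩ := hnp e 0
    exact hj (Or.inr ⟨fun h => hn (take_subset_events _ _ h), hA, Or.inl he⟩)
  -- An opponent's event foreign to `σ` was played because it was prudent, hence urgent, and
  -- liveness of `η` settles it.
  have hsetη : ∀ e ∈ events η, e ∉ events σ ∨ owner e = A → Settled Δ η e := by
    rintro e he h
    by_cases hA : owner e = A
    · exact hcf.settled hΔ he hA
    · have heσ := h.resolve_right hA
      obtain ⟨i, hi⟩ := he
      rcases hG i e (Nat.zero_le _) hi with h1 | h1
      · exact absurd (hS.1 _ (hη.isFinPlay_take _) _ h1).1 hA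
      · exact hliveη.settled hi (urgent_of_prudentEvent hΔ hfin (h1.2.2.resolve_left heσ))
  -- The finite sets to transfer are the events of `η` missing from `σ` in one direction, and the
  -- events of `A` in `σ` in the other.
  refine ⟨η, hpay, subset_antisymm ?_ ?_⟩
  · have hW : ∀ e ∈ events η \ events σ, Settled Δ η e := fun e he => hsetη e he.1 (Or.inl he.2)
    have := hlive.subset_events_of_settled hη
      (hfin.subset fun e he => (hW e he).mem_enabledEvents hΔ) hW
      (fun e he => by_contra fun h => he.2 ⟨he.1, h⟩)
    exact fun e he => by_contra fun h => h (this ⟨he, h⟩)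
  · have hW : ∀ e ∈ {e | e ∈ events σ ∧ owner e = A}, Settled Δ σ e := fun e he =>
      hset e he.1 he.2
    have := hliveη.subset_events_of_settled hp
      (hfin.subset fun e he => (hW e he).mem_enabledEvents hΔ) hW
      (fun e he => hN e he.1 fun h => he.2 ⟨he.1, h⟩)
    intro e he
    by_cases hA : owner e = A
    · exact this ⟨he, hA⟩
    · exact hN e he hA

theorem isWinningStrategy_urgentStrategy [Countable E] {C : Contract E Part}
    (hΔ : Corresponds Δ C.ces) (hfin : C.ces.enabledEvents.Finite)
    (hreach : IsReachabilityPayoff C.payoff) (hagree : ∃ S, IsWinningStrategy C owner A S) :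
    IsWinningStrategy C owner A (urgentStrategy Δ owner A) := by
  refine ⟨isStrategy_urgentStrategy hΔ, fun σ hp hf hc => ?_⟩
  have hA : Innocent C.ces owner A σ := innocent_of_fair hΔ hfin hf
  by_cases hB : ∃ B, B ≠ A ∧ ¬ Innocent C.ces owner B σ
  · exact Or.inr ⟨hA, hB⟩
  · push Not at hB
    have hinn : ∀ B, Innocent C.ces owner B σ := fun B => by
      by_cases h : B = A
      · exact h ▸ hA
      · exact hB B h
    have hlive : Live Δ σ := live_of_innocent hΔ hfin hp hinn
    have hset : ∀ e ∈ events σ, owner e = A → Settled Δ σ e := by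
      rintro e ⟨i, hi⟩ he
      exact hlive.settled hi (hc i e hi he).1
    obtain ⟨S, hS⟩ := hagree
    obtain ⟨η, hη, hev⟩ := exists_win_of_live hΔ hfin hS hp hlive hset
    exact Or.inl ⟨(hreach A η σ hev).1 hη, creditFree_of_settled hΔ hp hset, hinn⟩

end

end ContractGames

theorem mainTheorem3 {E : Type*} [Countable E] {Part : Type*} (owner : E → Part)
    (C : ContractGames.Contract E Part) (Δ : Set (ContractGames.HornClause E))
    (hΔ : ContractGames.Corresponds Δ C.ces) (hfin : C.ces.enabledEvents.Finite)
    (A : Part) :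
    ContractGames.IsPrudentStrategy C.ces owner A
        (ContractGames.urgentStrategy Δ owner A) ∧
      (ContractGames.IsReachabilityPayoff C.payoff →
        ContractGames.AdmitsAgreement C owner →
        ContractGames.IsWinningStrategy C owner A
          (ContractGames.urgentStrategy Δ owner A)) :=
  ⟨ContractGames.isPrudentStrategy_urgentStrategy hΔ hfin, fun hreach hagree =>
    ContractGames.isWinningStrategy_urgentStrategy hΔ hfin hreach (hagree A)⟩
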